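/- Let $\mathcal H,\mathcal K$ be finite-dimensional complex Hilbert spaces. A state on $\mathcal H$ is a positive semi-definite operator of trace one. For $\varepsilon\ge 0$, let $\mathcal A$ be an $\varepsilon$-QLDP mechanism, i.e. a linear, completely positive and trace-preserving map from the operators on $\mathcal H$ to the operators on $\mathcal K$ such that $$\operatorname{Tr}[M\mathcal A(\rho)]\le e^{\varepsilon}\operatorname{Tr}[M\mathcal A(\sigma)]$$ for all states $\rho,\sigma$ on $\mathcal H$ and all operators $M$ on $\mathcal K$ with $0\le M\le I$. Write $\|B\|_1=\operatorname{Tr}\sqrt{B^\dagger B}$, $T(\rho,\sigma)=\tfrac12\|\rho-\sigma\|_1$, $F(\rho,\sigma)=\|\sqrt\rho\sqrt\sigma\|_1^2$ and $[d_B(\rho,\sigma)]^2=2\bigl(1-\sqrt{F(\rho,\sigma)}\bigr)$. Then for all states $\rho,\sigma$ on $\mathcal H$, $$\bigl[d_B(\mathcal A(\rho),\mathcal A(\sigma))\bigr]^2\le 2\,\frac{(e^{\varepsilon/2}-1)^2}{e^{\varepsilon}+1}\,T(\rho,\sigma).$$ -/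

import Mathlib

open scoped CStarAlgebra

noncomputable section

namespace QLDP

variable {H K : Type*}
  [NormedAddCommGroup H] [InnerProductSpace ℂ H] [CompleteSpace H] [FiniteDimensional ℂ H]
  [NormedAddCommGroup K] [InnerProductSpace ℂ K] [CompleteSpace K] [FiniteDimensional ℂ K]

/-- The trace of an operator on a finite-dimensional Hilbert space. -/
def tr (X : H →L[ℂ] H) : ℂ := LinearMap.trace ℂ H (X : H →ₗ[ℂ] H)

/-- A quantum state: a positive semi-definite operator of unit trace. The order on operators is
the Loewner order. -/
structure IsState (ρ : H →L[ℂ] H) : Prop where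
  nonneg : 0 ≤ ρ
  tr_eq_one : tr ρ = 1

/-- A quantum channel: a linear, completely positive and trace-preserving map. -/
structure Channel (H K : Type*)
    [NormedAddCommGroup H] [InnerProductSpace ℂ H] [CompleteSpace H] [FiniteDimensional ℂ H]
    [NormedAddCommGroup K] [InnerProductSpace ℂ K] [CompleteSpace K] [FiniteDimensional ℂ K] where
  toCP : (H →L[ℂ] H) →CP (K →L[ℂ] K)
  tr_map : ∀ X : H →L[ℂ] H, tr (toCP X) = tr X

instance : CoeFun (Channel H K) (fun _ => (H →L[ℂ] H) → (K →L[ℂ] K)) where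
  coe A := A.toCP

/-- `(ε, δ)`-quantum local differential privacy. The traces `Tr[M A(ρ)]` are real, being traces of
products of two positive semi-definite operators. -/
def IsApproxQLDP (A : Channel H K) (ε δ : ℝ) : Prop :=
  ∀ ρ σ : H →L[ℂ] H, IsState ρ → IsState σ →
    ∀ M : K →L[ℂ] K, 0 ≤ M → M ≤ 1 →
      (tr (M * A ρ)).re ≤ Real.exp ε * (tr (M * A σ)).re + δ

/-- `ε`-quantum local differential privacy. -/
def IsQLDP (A : Channel H K) (ε : ℝ) : Prop := IsApproxQLDP A ε 0

/-- The trace norm `‖B‖₁ = Tr √(B† B)`; the trace of a positive semi-definite operator is real. -/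
def traceNorm (B : H →L[ℂ] H) : ℝ := (tr (CFC.sqrt (star B * B))).re

/-- The normalized trace distance `T(ρ, σ)`. -/
def traceDist (ρ σ : H →L[ℂ] H) : ℝ := 1 / 2 * traceNorm (ρ - σ)

/-- The Uhlmann fidelity `F(ρ, σ) = ‖√ρ √σ‖₁²`. -/
def fidelity (ρ σ : H →L[ℂ] H) : ℝ := traceNorm (CFC.sqrt ρ * CFC.sqrt σ) ^ 2

/-- The square `[d_B(ρ, σ)]² = 2 (1 - √F(ρ, σ))` of the Bures distance. -/
def buresDistSq (ρ σ : H →L[ℂ] H) : ℝ := 2 * (1 - Real.sqrt (fidelity ρ σ))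

end QLDP

end

namespace QLDP

set_option linter.unusedSectionVars false

variable {H K : Type*}
  [NormedAddCommGroup H] [InnerProductSpace ℂ H] [CompleteSpace H] [FiniteDimensional ℂ H]
  [NormedAddCommGroup K] [InnerProductSpace ℂ K] [CompleteSpace K] [FiniteDimensional ℂ K]

/-! Some orthonormal basis measurement attains the fidelity of `A ρ` and `A σ` (Fuchs–Caves), so the
squared Bures distance equals `∑ (√pᵢ - √qᵢ)²` for the measured distributions. Privacy keeps
`√(pᵢ/qᵢ)` in `[1/s, s]`, `s = e^(ε/2)`, so each term is at most `(s-1)/(s+1) * |pᵢ - qᵢ|`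
(`exists_basis_bures_le`). Privacy used again, on the Jordan parts of `ρ - σ`, contracts `∑ |pᵢ -
qᵢ|` by `(s²-1)/(s²+1)` (`IsQLDP.sum_abs_expVal_le`). The product of the factors is the constant. -/

/-- The real part of the expectation value `⟪v, X v⟫`. -/
noncomputable def expVal (X : H →L[ℂ] H) (v : H) : ℝ := (inner ℂ v (X v)).re

lemma tr_add (X Y : H →L[ℂ] H) : tr (X + Y) = tr X + tr Y := by simp [tr]

lemma tr_sub (X Y : H →L[ℂ] H) : tr (X - Y) = tr X - tr Y := by simp [tr]

lemma tr_smul (c : ℂ) (X : H →L[ℂ] H) : tr (c • X) = c * tr X := by simp [tr]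

lemma tr_mul_comm (X Y : H →L[ℂ] H) : tr (X * Y) = tr (Y * X) :=
  LinearMap.trace_mul_comm ℂ (X : H →ₗ[ℂ] H) (Y : H →ₗ[ℂ] H)

lemma re_tr_eq_sum {ι : Type*} [Fintype ι] (b : OrthonormalBasis ι ℂ H) (X : H →L[ℂ] H) :
    (tr X).re = ∑ i, expVal X (b i) := by
  rw [tr, LinearMap.trace_eq_sum_inner _ b, Complex.re_sum]
  rfl

lemma continuous_tr : Continuous (tr : (H →L[ℂ] H) → ℂ) :=
  LinearMap.continuous_of_finiteDimensional
    ((LinearMap.trace ℂ H).comp (ContinuousLinearMap.coeLM ℂ))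

lemma expVal_add (X Y : H →L[ℂ] H) (v : H) : expVal (X + Y) v = expVal X v + expVal Y v := by
  simp [expVal]

lemma expVal_sub (X Y : H →L[ℂ] H) (v : H) : expVal (X - Y) v = expVal X v - expVal Y v := by
  simp [expVal]

lemma expVal_nonneg {X : H →L[ℂ] H} (hX : 0 ≤ X) (v : H) : 0 ≤ expVal X v :=
  ((ContinuousLinearMap.nonneg_iff_isPositive X).1 hX).re_inner_nonneg_right v

lemma re_tr_nonneg {X : H →L[ℂ] H} (hX : 0 ≤ X) : 0 ≤ (tr X).re := by
  rw [re_tr_eq_sum (stdOrthonormalBasis ℂ H)]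
  exact Finset.sum_nonneg fun i _ => expVal_nonneg hX _

lemma ofReal_re_tr {X : H →L[ℂ] H} (hX : 0 ≤ X) : ((tr X).re : ℂ) = tr X := by
  have h := LinearMap.IsPositive.trace_nonneg
    ((ContinuousLinearMap.isPositive_toLinearMap_iff X).2
      ((ContinuousLinearMap.nonneg_iff_isPositive X).1 hX))
  exact Complex.ext rfl (RCLike.nonneg_iff.1 h).2.symm

lemma expVal_star_mul_self (S : H →L[ℂ] H) (v : H) : expVal (star S * S) v = ‖S v‖ ^ 2 := by
  rw [expVal, ContinuousLinearMap.star_eq_adjoint, mul_apply_eq_comp,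
    ContinuousLinearMap.adjoint_inner_right, inner_self_eq_norm_sq_to_K]
  norm_cast

lemma eq_zero_of_re_tr_eq_zero {X : H →L[ℂ] H} (hX : 0 ≤ X) (h : (tr X).re = 0) : X = 0 := by
  obtain ⟨S, rfl⟩ := CStarAlgebra.nonneg_iff_eq_star_mul_self.1 hX
  let b := stdOrthonormalBasis ℂ H
  rw [re_tr_eq_sum b, Finset.sum_eq_zero_iff_of_nonneg fun i _ => expVal_nonneg hX _] at h
  suffices hS : S = 0 by simp [hS]
  apply ContinuousLinearMap.coe_injective
  refine b.toBasis.ext fun i => ?_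
  simpa [expVal_star_mul_self] using h i (Finset.mem_univ i)

lemma traceNorm_nonneg (B : H →L[ℂ] H) : 0 ≤ traceNorm B := re_tr_nonneg (CFC.sqrt_nonneg _)

/-- A positive solution `M` of `M Q M = P`, which is Fuchs and Caves' optimal observable. -/
lemma exists_nonneg_mul_mul_eq {P Q : K →L[ℂ] K} (hP : 0 ≤ P) (hQ : IsStrictlyPositive Q) :
    ∃ M : K →L[ℂ] K, 0 ≤ M ∧ M * Q * M = P ∧
      (tr (M * Q)).re = traceNorm (CFC.sqrt P * CFC.sqrt Q) := by
  set S := CFC.sqrt Q with hS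
  have hSpos : IsStrictlyPositive S := hQ.sqrt
  have hS0 : 0 ≤ S := hSpos.nonneg
  have hSS : S * S = Q := CFC.sqrt_mul_sqrt_self Q hQ.nonneg
  set R := Ring.inverse S
  have hRS : R * S = 1 := Ring.inverse_mul_cancel _ hSpos.isUnit
  have hSR : S * R = 1 := Ring.mul_inverse_cancel _ hSpos.isUnit
  have hR0 : 0 ≤ R := hSpos.ringInverse.nonneg
  have hstar : star (CFC.sqrt P * S) * (CFC.sqrt P * S) = S * P * S := by
    rw [star_mul, (IsSelfAdjoint.of_nonneg hS0).star_eq,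
      (IsSelfAdjoint.of_nonneg (CFC.sqrt_nonneg P)).star_eq, mul_assoc,
      ← mul_assoc (CFC.sqrt P) (CFC.sqrt P), CFC.sqrt_mul_sqrt_self P, ← mul_assoc]
  have hSPS : 0 ≤ S * P * S := hstar ▸ star_mul_self_nonneg _
  set W := CFC.sqrt (S * P * S) with hW
  have hWW : W * W = S * P * S := CFC.sqrt_mul_sqrt_self _ hSPS
  have hW0 : 0 ≤ W := CFC.sqrt_nonneg _
  -- This is `Q^(-1/2) (Q^(1/2) P Q^(1/2))^(1/2) Q^(-1/2)`; its middle factor is `|√P √Q|`.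
  refine ⟨R * W * R, ?_, ?_, ?_⟩
  · simpa [(IsSelfAdjoint.of_nonneg hR0).star_eq] using star_left_conjugate_nonneg hW0 R
  · calc R * W * R * Q * (R * W * R) = R * W * (R * S) * (S * R) * W * R := by
          rw [← hSS]; noncomm_ring
      _ = R * (W * W) * R := by rw [hRS, hSR]; noncomm_ring
      _ = (R * S) * P * (S * R) := by rw [hWW]; noncomm_ring
      _ = P := by rw [hRS, hSR]; simp
  · have h : R * W * R * Q = R * (W * S) := by
      calc R * W * R * Q = R * W * (R * S) * S := by rw [← hSS]; noncomm_ring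
        _ = R * (W * S) := by rw [hRS]; noncomm_ring
    rw [traceNorm, hstar, h, tr_mul_comm, mul_assoc, hSR, mul_one]

/-- The left side is `(l-1)² q` and `|p - q| = |l-1| (l+1) q`; the quotient `|l-1|/(l+1)` is largest
on `[1/s, s]` at the endpoints. -/
lemma add_sub_two_mul_le {s l p q : ℝ} (hs : 1 ≤ s) (hl : 0 ≤ l) (hq : 0 ≤ q)
    (hp : p = l ^ 2 * q) (hpq : p ≤ s ^ 2 * q) (hqp : q ≤ s ^ 2 * p) :
    p + q - 2 * (l * q) ≤ (s - 1) / (s + 1) * |p - q| := by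
  subst hp
  rcases hq.eq_or_lt with rfl | hq
  · simp
  have h1 : l ≤ s := by
    refine le_of_sq_le_sq (le_of_mul_le_mul_right hpq hq) (by linarith)
  have h2 : 1 ≤ s * l := by
    have : (1 : ℝ) ^ 2 ≤ (s * l) ^ 2 := le_of_mul_le_mul_right (by linarith) hq
    exact le_of_sq_le_sq this (by positivity)
  have h3 : |l - 1| * (s + 1) ≤ (s - 1) * (l + 1) := by
    rcases abs_cases (l - 1) with ⟨h, _⟩ | ⟨h, _⟩ <;> rw [h] <;> linarith
  have h4 : |l ^ 2 * q - q| = |l - 1| * (l + 1) * q := by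
    rw [show l ^ 2 * q - q = (l - 1) * (l + 1) * q by ring, abs_mul, abs_mul, abs_of_pos hq,
      abs_of_pos (by linarith : 0 < l + 1)]
  rw [h4, div_mul_eq_mul_div, le_div_iff₀ (by linarith)]
  have h5 := mul_le_mul_of_nonneg_left h3 (mul_nonneg (abs_nonneg (l - 1)) hq.le)
  have h6 := abs_mul_abs_self (l - 1)
  calc _ = (|l - 1| * |l - 1|) * q * (s + 1) := by rw [h6]; ring
    _ = |l - 1| * q * (|l - 1| * (s + 1)) := by ring
    _ ≤ _ := h5
    _ = _ := by ring

/-- If `P` and `Q` have expectation values within a factor `s ^ 2` of each other, then some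
orthonormal basis bounds their unnormalized squared Bures distance by `(s - 1) / (s + 1)` times
the total variation between the measured distributions. -/
lemma exists_basis_bures_le {P Q : K →L[ℂ] K} {s : ℝ} (hs : 1 ≤ s) (hP : 0 ≤ P)
    (hQ : IsStrictlyPositive Q) (hPQ : ∀ v, ‖v‖ = 1 → expVal P v ≤ s ^ 2 * expVal Q v)
    (hQP : ∀ v, ‖v‖ = 1 → expVal Q v ≤ s ^ 2 * expVal P v) :
    ∃ b : OrthonormalBasis (Fin (Module.finrank ℂ K)) ℂ K,
      (tr P).re + (tr Q).re - 2 * traceNorm (CFC.sqrt P * CFC.sqrt Q) ≤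
        (s - 1) / (s + 1) * ∑ i, |expVal (P - Q) (b i)| := by
  obtain ⟨M, hM, hMQM, htr⟩ := exists_nonneg_mul_mul_eq hP hQ
  have hMpos := (ContinuousLinearMap.nonneg_iff_isPositive M).1 hM
  have hsym : (M : K →ₗ[ℂ] K).IsSymmetric := hMpos.isSymmetric
  -- In an eigenbasis of `M`, `M Q M = P` becomes `pᵢ = lᵢ² qᵢ`, and `tr (M Q) = ∑ lᵢ qᵢ`.
  let b := hsym.eigenvectorBasis rfl
  refine ⟨b, ?_⟩
  rw [← htr, re_tr_eq_sum b, re_tr_eq_sum b, re_tr_eq_sum b, Finset.mul_sum, Finset.mul_sum,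
    ← Finset.sum_add_distrib, ← Finset.sum_sub_distrib]
  refine Finset.sum_le_sum fun i _ => ?_
  set l := hsym.eigenvalues rfl i with hl
  have hb : ‖b i‖ = 1 := b.orthonormal.1 i
  have hMb : M (b i) = (l : ℂ) • b i := hsym.apply_eigenvectorBasis rfl i
  have hmove : ∀ x, inner ℂ (b i) (M x) = (l : ℂ) * inner ℂ (b i) x := fun x => by
    rw [← show inner ℂ (M (b i)) x = inner ℂ (b i) (M x) from hsym _ _, hMb, inner_smul_left,
      Complex.conj_ofReal]
  have hMQ : expVal (M * Q) (b i) = l * expVal Q (b i) := by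
    rw [expVal, mul_apply_eq_comp, hmove, Complex.re_ofReal_mul, expVal]
  have hPb : expVal P (b i) = l ^ 2 * expVal Q (b i) := by
    rw [← hMQM, expVal, mul_apply_eq_comp, mul_apply_eq_comp, hmove, hMb,
      map_smul, inner_smul_right, Complex.re_ofReal_mul, Complex.re_ofReal_mul, expVal]
    ring
  have hl0 : 0 ≤ l := by
    have h := hMpos.re_inner_nonneg_right (b i)
    rw [hMb, inner_smul_right, inner_self_eq_norm_sq_to_K, hb] at h
    simpa using h
  rw [hMQ, expVal_sub]
  exact add_sub_two_mul_le hs hl0 (expVal_nonneg hQ.nonneg _) hPb (hPQ _ hb) (hQP _ hb)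

lemma Channel.map_nonneg (A : Channel H K) {X : H →L[ℂ] H} (hX : 0 ≤ X) : 0 ≤ A X := by
  have h := OrderHomClass.mono A.toCP hX
  rwa [map_zero] at h

lemma re_tr_rankOne_mul (X : K →L[ℂ] K) (v : K) :
    (tr (InnerProductSpace.rankOne ℂ v v * X)).re = expVal X v := by
  rw [tr_mul_comm, ContinuousLinearMap.mul_def, InnerProductSpace.comp_rankOne]
  exact congrArg Complex.re (InnerProductSpace.trace_rankOne (𝕜 := ℂ) (X v) v)

lemma rankOne_le_one {v : K} (hv : ‖v‖ = 1) : InnerProductSpace.rankOne ℂ v v ≤ 1 := by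
  have h : IsStarProjection (InnerProductSpace.rankOne ℂ v v) :=
    ⟨InnerProductSpace.isIdempotentElem_rankOne_self hv,
      (InnerProductSpace.isPositive_rankOne_self v).isSelfAdjoint⟩
  exact h.le_one

lemma IsQLDP.expVal_le {A : Channel H K} {ε : ℝ} (hA : IsQLDP A ε) {ρ σ : H →L[ℂ] H}
    (hρ : IsState ρ) (hσ : IsState σ) {v : K} (hv : ‖v‖ = 1) :
    expVal (A ρ) v ≤ Real.exp ε * expVal (A σ) v := by
  have h := hA ρ σ hρ hσ (InnerProductSpace.rankOne ℂ v v)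
    ((ContinuousLinearMap.nonneg_iff_isPositive _).2 (InnerProductSpace.isPositive_rankOne_self v))
    (rankOne_le_one hv)
  rwa [re_tr_rankOne_mul, re_tr_rankOne_mul, add_zero] at h

lemma isState_inv_smul {X : H →L[ℂ] H} (hX : 0 ≤ X) (h : (tr X).re ≠ 0) :
    IsState ((((tr X).re⁻¹ : ℝ) : ℂ) • X) where
  nonneg := by
    exact (ContinuousLinearMap.nonneg_iff_isPositive _).2
      (((ContinuousLinearMap.nonneg_iff_isPositive X).1 hX).smul_of_nonneg
        (RCLike.ofReal_nonneg.2 (inv_nonneg.2 (re_tr_nonneg hX))))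
  tr_eq_one := by
    rw [tr_smul, ← ofReal_re_tr hX]
    norm_cast
    simp [h]

/-- Both operators are rescaled to states by the same factor; if the common trace is zero, both
vanish. -/
lemma IsQLDP.expVal_le_of_tr_eq {A : Channel H K} {ε : ℝ} (hA : IsQLDP A ε) {X Y : H →L[ℂ] H}
    (hX : 0 ≤ X) (hY : 0 ≤ Y) (hXY : (tr X).re = (tr Y).re) {v : K} (hv : ‖v‖ = 1) :
    expVal (A X) v ≤ Real.exp ε * expVal (A Y) v := by
  by_cases h : (tr X).re = 0
  · rw [eq_zero_of_re_tr_eq_zero hX h, eq_zero_of_re_tr_eq_zero hY (hXY ▸ h)]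
    simp [expVal]
  · have h1 := hA.expVal_le (isState_inv_smul hX h) (isState_inv_smul hY (hXY ▸ h)) hv
    have hsm : ∀ (c : ℝ) (Z : H →L[ℂ] H), expVal (A ((c : ℂ) • Z)) v = c * expVal (A Z) v :=
      fun c Z => by
        rw [expVal, map_smul, smul_apply, inner_smul_right,
          Complex.re_ofReal_mul, expVal]
    rw [hsm, hsm, ← hXY, mul_left_comm] at h1
    have h0 : 0 < (tr X).re⁻¹ := inv_pos.2 ((re_tr_nonneg hX).lt_of_ne' h)
    exact le_of_mul_le_mul_left h1 h0

lemma abs_sub_le_div_mul_add {t a b : ℝ} (ht : 0 < t + 1) (hab : a ≤ t * b) (hba : b ≤ t * a) :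
    |a - b| ≤ (t - 1) / (t + 1) * (a + b) := by
  rw [div_mul_eq_mul_div, le_div_iff₀ ht]
  rcases abs_cases (a - b) with ⟨h, _⟩ | ⟨h, _⟩ <;> rw [h] <;> linarith

/-- Measured in any orthonormal basis, an `ε`-QLDP channel contracts the trace distance by
`(e^ε - 1) / (e^ε + 1)`. -/
lemma IsQLDP.sum_abs_expVal_le {A : Channel H K} {ε : ℝ} (hA : IsQLDP A ε) {ρ σ : H →L[ℂ] H}
    (hρ : IsState ρ) (hσ : IsState σ) {ι : Type*} [Fintype ι] (b : OrthonormalBasis ι ℂ K) :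
    ∑ i, |expVal (A ρ - A σ) (b i)| ≤
      (Real.exp ε - 1) / (Real.exp ε + 1) * (2 * traceDist ρ σ) := by
  have hX : IsSelfAdjoint (ρ - σ) :=
    (IsSelfAdjoint.of_nonneg hρ.nonneg).sub (IsSelfAdjoint.of_nonneg hσ.nonneg)
  set X := ρ - σ with hXdef
  have hp : 0 ≤ X⁺ := CFC.posPart_nonneg X
  have hn : 0 ≤ X⁻ := CFC.negPart_nonneg X
  have hsub : X⁺ - X⁻ = X := CFC.posPart_sub_negPart X hX
  -- `ρ - σ` is traceless, so privacy can compare its two Jordan parts.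
  have htr : (tr X⁺).re = (tr X⁻).re := by
    have h := congrArg tr hsub
    rw [tr_sub, hXdef, tr_sub, hρ.tr_eq_one, hσ.tr_eq_one, sub_self, sub_eq_zero] at h
    rw [h]
  have hdist : 2 * traceDist ρ σ = (tr (A X⁺)).re + (tr (A X⁻)).re := by
    rw [A.tr_map, A.tr_map, ← Complex.add_re, ← tr_add, CFC.posPart_add_negPart X hX, traceDist,
      traceNorm, CFC.abs]
    ring
  rw [hdist, re_tr_eq_sum b, re_tr_eq_sum b, ← Finset.sum_add_distrib, Finset.mul_sum]
  refine Finset.sum_le_sum fun i _ => ?_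
  have hb : ‖b i‖ = 1 := b.orthonormal.1 i
  rw [← map_sub, ← hXdef, ← hsub, map_sub, expVal_sub, hsub]
  exact abs_sub_le_div_mul_add (by positivity) (hA.expVal_le_of_tr_eq hp hn htr hb)
    (hA.expVal_le_of_tr_eq hn hp htr.symm hb)

lemma expVal_add_algebraMap (X : K →L[ℂ] K) (η : ℝ) {v : K} (hv : ‖v‖ = 1) :
    expVal (X + algebraMap ℝ (K →L[ℂ] K) η) v = expVal X v + η := by
  rw [expVal_add, Algebra.algebraMap_eq_smul_one, add_right_inj, expVal,
    smul_apply, one_apply_eq_self, inner_smul_right_eq_smul,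
    inner_self_eq_norm_sq_to_K, hv]
  simp

end QLDP

theorem mainTheorem6 {H K : Type*}
    [NormedAddCommGroup H] [InnerProductSpace ℂ H] [CompleteSpace H] [FiniteDimensional ℂ H]
    [NormedAddCommGroup K] [InnerProductSpace ℂ K] [CompleteSpace K] [FiniteDimensional ℂ K]
    (ε : ℝ) (hε : 0 ≤ ε) (A : QLDP.Channel H K) (hA : QLDP.IsQLDP A ε)
    (ρ σ : H →L[ℂ] H) (hρ : QLDP.IsState ρ) (hσ : QLDP.IsState σ) :
    QLDP.buresDistSq (A ρ) (A σ) ≤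
      2 * ((Real.exp (ε / 2) - 1) ^ 2 / (Real.exp ε + 1)) * QLDP.traceDist ρ σ := by
  open QLDP in
  set s := Real.exp (ε / 2)
  have hs : 1 ≤ s := Real.one_le_exp (by linarith)
  have hs2 : Real.exp ε = s ^ 2 := by rw [← Real.exp_nat_mul]; congr 1; push_cast; ring
  have hconst : (s - 1) / (s + 1) * ((Real.exp ε - 1) / (Real.exp ε + 1) * (2 * traceDist ρ σ)) =
      2 * ((s - 1) ^ 2 / (Real.exp ε + 1)) * traceDist ρ σ := by
    have h : s + 1 ≠ 0 := by linarith
    have h' : s ^ 2 + 1 ≠ 0 := by positivity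
    rw [hs2]; field_simp; ring
  rw [← hconst, buresDistSq, fidelity, Real.sqrt_sq (traceNorm_nonneg _)]
  -- `A σ` may be singular. Adding `η • 1` makes it invertible, leaves the difference unchanged, and
  -- preserves the ratio bounds because `s² ≥ 1`.
  let pert (X : K →L[ℂ] K) (η : ℝ) : K →L[ℂ] K := X + algebraMap ℝ (K →L[ℂ] K) η
  have hmain : ∀ η : ℝ, 0 < η →
      (tr (pert (A ρ) η)).re + (tr (pert (A σ) η)).re -
        2 * traceNorm (CFC.sqrt (pert (A ρ) η) * CFC.sqrt (pert (A σ) η)) ≤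
      (s - 1) / (s + 1) * ((Real.exp ε - 1) / (Real.exp ε + 1) * (2 * traceDist ρ σ)) := by
    intro η hη
    have hη' : IsStrictlyPositive (algebraMap ℝ (K →L[ℂ] K) η) := 
      isStrictlyPositive_algebraMap hη
    have hle : η ≤ s ^ 2 * η := le_mul_of_one_le_left hη.le (one_le_pow₀ hs)
    obtain ⟨b, hb⟩ := exists_basis_bures_le (P := pert (A ρ) η) (Q := pert (A σ) η) hs
      (add_nonneg (A.map_nonneg hρ.nonneg) hη'.nonneg)
      (hη'.nonneg_add (A.map_nonneg hσ.nonneg))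
      (fun v hv => by
        have h := hA.expVal_le hρ hσ hv
        rw [expVal_add_algebraMap _ _ hv, expVal_add_algebraMap _ _ hv]
        rw [hs2] at h; linarith)
      (fun v hv => by
        have h := hA.expVal_le hσ hρ hv
        rw [expVal_add_algebraMap _ _ hv, expVal_add_algebraMap _ _ hv]
        rw [hs2] at h; linarith)
    refine hb.trans (mul_le_mul_of_nonneg_left ?_ (div_nonneg (by linarith) (by linarith)))
    simpa only [pert, add_sub_add_right_eq_sub] using hA.sum_abs_expVal_le hρ hσ b
  have hnonneg : ∀ X : K →L[ℂ] K, 0 ≤ X → ∀ η ∈ Set.Ici (0 : ℝ), 0 ≤ pert X η := fun X hX η hη =>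
    add_nonneg hX (algebraMap_nonneg _ hη)
  have hpert : ∀ X : K →L[ℂ] K, Continuous (pert X) := fun X =>
    continuous_const.add (continuous_algebraMap ℝ (K →L[ℂ] K))
  have hsqrt : ∀ X : K →L[ℂ] K, 0 ≤ X →
      ContinuousOn (fun η => CFC.sqrt (pert X η)) (Set.Ici 0) := fun X hX =>
    CFC.continuousOn_sqrt.comp (hpert X).continuousOn (hnonneg X hX)
  have hnorm : Continuous (traceNorm : (K →L[ℂ] K) → ℝ) :=
    Complex.continuous_re.comp (continuous_tr.comp CFC.continuous_abs)
  have hcont : ContinuousOn (fun η : ℝ => (tr (pert (A ρ) η)).re + (tr (pert (A σ) η)).re -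
      2 * traceNorm (CFC.sqrt (pert (A ρ) η) * CFC.sqrt (pert (A σ) η))) (Set.Ici 0) := by
    have htr : ∀ X : K →L[ℂ] K, Continuous fun η => (tr (pert X η)).re := fun X =>
      Complex.continuous_re.comp (continuous_tr.comp (hpert X))
    exact ((htr _).add (htr _)).continuousOn.sub (continuousOn_const.mul
      (hnorm.comp_continuousOn ((hsqrt _ (A.map_nonneg hρ.nonneg)).mul
        (hsqrt _ (A.map_nonneg hσ.nonneg)))))
  -- The bound holds for `η > 0` and passes to `η = 0` by one-sided continuity.
  have hlim := ((hcont 0 Set.self_mem_Ici).mono Set.Ioi_subset_Ici_self).tendsto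
  have h0 := le_of_tendsto hlim (eventually_nhdsWithin_of_forall hmain)
  have hp0 : ∀ X : K →L[ℂ] K, pert X 0 = X := fun X => by simp [pert]
  rw [hp0, hp0, A.tr_map, A.tr_map, hρ.tr_eq_one, hσ.tr_eq_one, Complex.one_re] at h0
  linarith
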